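/- Let $A$ be a $C^*$-algebra (not necessarily unital) and let $H$ be a Hilbert $A$-module, i.e. a complex vector space with an action of $A$ and an $A$-valued inner product $\langle\cdot,\cdot\rangle$ that is linear over $\mathbb{C}$ and $A$ in the second variable, satisfies $\langle y,x\rangle=\langle x,y\rangle^*$ and $\langle x,x\rangle\ge 0$ with equality only for $x=0$, and is such that $H$ is complete for the norm $\|x\|=\|\langle x,x\rangle\|^{1/2}$. (The action is written on the left; a right Hilbert module over a $C^*$-algebra $\mathfrak{A}$ is the case where $A=\mathfrak{A}^{\mathrm{op}}$ is the opposite algebra.) For a submodule $M$ of $H$ put $$M^\perp=\{x\in H : \langle x,y\rangle=0\ \text{for all } y\in M\},$$ and call a closed submodule $M$ orthogonally complemented if $H$ is the direct sum of $M$ and $M^\perp$. Proposition 4.6. Let $M$ and $N$ be two orthogonally complemented closed submodules of $H$ such that $M+N$ is closed in $H$. Then $M+N$ and $M\cap N$ are both orthogonally complemented closed submodules of $H$, and $$(M\cap N)^\perp=M^\perp+N^\perp .$$ -/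

import Mathlib

section HilbertModule

/- `A` is a C⋆-algebra (unital or not, with its canonical order) and `H` a Hilbert `A`-module in the
sense of Mathlib's `CStarModule`: the inner product is `A`-valued, linear in the second variable
over `ℂ` and over `A`, and induces the norm of `H`.  A right Hilbert `B`-module is the case
`A = Bᵐᵒᵖ`. -/
variable (A : Type*) {H : Type*} [NonUnitalCStarAlgebra A] [PartialOrder A] [StarOrderedRing A]
  [NormedAddCommGroup H] [NormedSpace ℂ H] [SMul A H] [CStarModule A H]

/-- The orthogonal complement `M^⊥ = {x ∈ H | ⟪x, y⟫ = 0 for all y ∈ M}` with respect to the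
`A`-valued inner product. -/
def orthCompl (M : Submodule ℂ H) : Submodule ℂ H where
  carrier := {x | ∀ y ∈ M, inner A x y = 0}
  zero_mem' := fun y _ => CStarModule.inner_zero_left
  add_mem' := fun {x x'} hx hx' y hy => by
    rw [CStarModule.inner_add_left, hx y hy, hx' y hy, add_zero]
  smul_mem' := fun c x hx y hy => by
    rw [CStarModule.inner_smul_left_complex, hx y hy, smul_zero]

/-- `M` is a closed submodule of the Hilbert `A`-module `H`: a linear subspace that is stable under
the action of `A` and closed for the norm. -/
structure IsClosedSubmodule (M : Submodule ℂ H) : Prop where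
  smul_mem : ∀ (a : A) (x : H), x ∈ M → a • x ∈ M
  isClosed : IsClosed (M : Set H)

/-- `M` is an orthogonally complemented closed submodule: `H` is the direct sum of `M` and
`M^⊥`. -/
structure IsOrthComplemented (M : Submodule ℂ H) : Prop where
  isClosedSubmodule : IsClosedSubmodule A M
  isCompl : IsCompl M (orthCompl A M)

end HilbertModule

/-!
Let `P` and `Q` be the orthogonal projections onto `M` and `N`, and let `S = (1 - Q) P`, whose adjoint
is `S' = P (1 - Q)`.  Since `M + N = N ⊕ (1 - Q) M`, the range of `S` is `(M + N) ∩ ker Q`, which is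
closed.  An adjointable operator with closed range satisfies `H = range S + ker S'` and
`H = range S' + ker S` (`exists_adjoint_apply_sub_eq_zero`, `exists_apply_sub_adjoint_eq_zero`).
The first decomposition, applied to `x`, writes `x` as an element of `M + N` plus one of
`M^⊥ ∩ N^⊥ = (M + N)^⊥`.  The second writes `x` as an element of `M ∩ N` plus one of
`M^⊥ + N^⊥ ⊆ (M ∩ N)^⊥`, because `S x = 0` means `P x ∈ M ∩ N`.

Closed submodules of a Hilbert module need not be complemented, unlike in Hilbert spaces, so the two
decompositions rest on the invertibility of `S S'` on the range of `S`.  By the open mapping theorem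
`S'` is bounded below on the range of `S`.  As `S S'` is positive, all the operators `S S' + t` with
`t ≥ 0` are then bounded below by one common constant, and invertibility propagates from large `t`
down to `t = 0` (`surjective_of_norm_le_add_smul`).
-/

/-! ### Surjectivity by continuation -/

/-- If the operators `B + t`, `t ≥ 0`, are bounded below by a constant independent of `t`, then `B`
is surjective: invertibility holds for large `t` and extends over steps of a fixed length. -/
theorem surjective_of_norm_le_add_smul {X : Type*} [NormedAddCommGroup X] [NormedSpace ℂ X]
    [CompleteSpace X] (B : X →L[ℂ] X) {K : ℝ} (hK : 0 < K)
    (hB : ∀ t : ℝ, 0 ≤ t → ∀ y, ‖y‖ ≤ K * ‖B y + (t : ℂ) • y‖) :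
    Function.Surjective B := by
  let T : ℝ → X →L[ℂ] X := fun t => B + (t : ℂ) • 1
  have step (s t : ℝ) (ht : 0 ≤ t) (hst : K * |t - s| < 1) (hu : IsUnit (T t)) :
      IsUnit (T s) := by
    obtain ⟨u, hu⟩ := hu
    set R : X →L[ℂ] X := ((u⁻¹ : (X →L[ℂ] X)ˣ) : X →L[ℂ] X) with hR
    have hinv : ‖R‖ ≤ K := by
      refine ContinuousLinearMap.opNorm_le_bound _ hK.le fun y => ?_
      have h2 : T t (R y) = y := by
        rw [← hu]
        exact congrArg (fun f : X →L[ℂ] X => f y) u.mul_inv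
      calc ‖R y‖ ≤ K * ‖T t (R y)‖ := hB t ht (R y)
        _ = K * ‖y‖ := by rw [h2]
    have hT : T s = u * (1 - ((t - s : ℝ) : ℂ) • R) := by
      rw [mul_sub, mul_one, mul_smul_comm, hR, Units.mul_inv, hu]
      simp only [T]
      push_cast
      module
    rw [hT]
    refine u.isUnit.mul (isUnit_one_sub_of_norm_lt_one ?_)
    rw [norm_smul, Complex.norm_real, Real.norm_eq_abs]
    calc |t - s| * _ ≤ |t - s| * K := by gcongr
      _ < 1 := by rwa [mul_comm]
  let t₀ : ℝ := ‖B‖ + 1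
  have ht₀ : 0 < t₀ := by positivity
  have start : IsUnit (T t₀) := by
    have hT : T t₀ = (t₀ : ℂ) • (1 - (-(t₀ : ℂ)⁻¹) • B) := by
      have : (t₀ : ℂ) ≠ 0 := by exact_mod_cast ht₀.ne'
      simp only [T, smul_sub, smul_smul, mul_neg, mul_inv_cancel₀ this]
      module
    rw [hT]
    refine IsUnit.smul (Units.mk0 (t₀ : ℂ) (by exact_mod_cast ht₀.ne'))
      (isUnit_one_sub_of_norm_lt_one ?_)
    rw [norm_smul, norm_neg, norm_inv, Complex.norm_real, Real.norm_of_nonneg ht₀.le,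
      inv_mul_lt_iff₀ ht₀]
    simp [t₀]
  have hall (n : ℕ) : IsUnit (T (max (t₀ - n * (2 * K)⁻¹) 0)) := by
    induction n with
    | zero => simpa [max_eq_left ht₀.le] using start
    | succ n ih =>
      refine step _ _ (le_max_right _ _) ?_ ih
      have h := abs_max_sub_max_le_abs (t₀ - n * (2 * K)⁻¹) (t₀ - (n + 1 : ℕ) * (2 * K)⁻¹) 0
      rw [show t₀ - n * (2 * K)⁻¹ - (t₀ - (n + 1 : ℕ) * (2 * K)⁻¹) = (2 * K)⁻¹ by
        push_cast; ring, abs_of_pos (show 0 < (2 * K)⁻¹ by positivity)] at h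
      calc _ ≤ K * (2 * K)⁻¹ := by gcongr
        _ < 1 := by field_simp; norm_num
  obtain ⟨n, hn⟩ := exists_nat_ge (t₀ * (2 * K))
  have h0 := hall n
  rw [max_eq_right (by
    rw [sub_nonpos, ← div_eq_mul_inv, le_div_iff₀ (by positivity)]; exact hn)] at h0
  obtain ⟨u, hu⟩ := h0
  intro y
  have h2 : T 0 (((u⁻¹ : (X →L[ℂ] X)ˣ) : X →L[ℂ] X) y) = y := by
    rw [← hu]
    exact congrArg (fun f : X →L[ℂ] X => f y) u.mul_inv
  exact ⟨_, by simpa [T] using h2⟩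

section HilbertModule

variable {A H : Type*} [NonUnitalCStarAlgebra A] [PartialOrder A]
  [NormedAddCommGroup H] [NormedSpace ℂ H] [SMul A H] [CStarModule A H]

/-! ### Orthogonality and orthogonal projections -/

theorem inner_eq_zero_symm_of_cstarModule {x y : H} (h : inner A x y = 0) : inner A y x = 0 := by
  rw [← CStarModule.star_inner, h, star_zero]

theorem disjoint_orthCompl (M : Submodule ℂ H) : Disjoint M (orthCompl A M) :=
  Submodule.disjoint_def.2 fun x hx hx' => CStarModule.inner_self.1 (hx' x hx)

theorem orthCompl_anti {M N : Submodule ℂ H} (h : M ≤ N) : orthCompl A N ≤ orthCompl A M :=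
  fun _ hx y hy => hx y (h hy)

theorem mem_orthCompl_sup {M N : Submodule ℂ H} {x : H} (hM : x ∈ orthCompl A M)
    (hN : x ∈ orthCompl A N) : x ∈ orthCompl A (M ⊔ N) := by
  intro y hy
  obtain ⟨m, hm, n, hn, rfl⟩ := Submodule.mem_sup.1 hy
  rw [CStarModule.inner_add_right, hM m hm, hN n hn, add_zero]

/-- The class `CStarModule` assumes no law for the action of `A`; additivity follows from the
nondegeneracy of the inner product. -/
theorem cstarModule_smul_add (a : A) (x y : H) : a • (x + y) = a • x + a • y := by
  rw [← sub_eq_zero, ← CStarModule.inner_self (A := A)]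
  simp only [CStarModule.inner_sub_right, CStarModule.inner_add_right,
    CStarModule.inner_op_smul_right, mul_add, sub_self]

theorem sup_smul_mem {M N : Submodule ℂ H} (hM : ∀ (a : A) (x : H), x ∈ M → a • x ∈ M)
    (hN : ∀ (a : A) (x : H), x ∈ N → a • x ∈ N) (a : A) (x : H) (hx : x ∈ M ⊔ N) :
    a • x ∈ M ⊔ N := by
  obtain ⟨m, hm, n, hn, rfl⟩ := Submodule.mem_sup.1 hx
  rw [cstarModule_smul_add]
  exact Submodule.add_mem_sup (hM a m hm) (hN a n hn)

theorem projection_apply_of_mem {M : Submodule ℂ H} {P : H →L[ℂ] H} (hP : ∀ x, P x ∈ M)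
    (hP' : ∀ x, x - P x ∈ orthCompl A M) {x : H} (hx : x ∈ M) : P x = x :=
  (sub_eq_zero.1 (Submodule.disjoint_def.1 (disjoint_orthCompl M) _
    (sub_mem hx (hP x)) (hP' x))).symm

theorem projection_apply_of_mem_orthCompl {M : Submodule ℂ H} {P : H →L[ℂ] H}
    (hP : ∀ x, P x ∈ M) (hP' : ∀ x, x - P x ∈ orthCompl A M) {x : H}
    (hx : x ∈ orthCompl A M) : P x = 0 :=
  Submodule.disjoint_def.1 (disjoint_orthCompl M) _ (hP x)
    (by simpa using sub_mem hx (hP' x))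

theorem mem_orthCompl_of_projection_eq_zero {M : Submodule ℂ H} {P : H →L[ℂ] H}
    (hP' : ∀ x, x - P x ∈ orthCompl A M) {x : H} (hx : P x = 0) : x ∈ orthCompl A M := by
  simpa [hx] using hP' x

theorem inner_projection_left {M : Submodule ℂ H} {P : H →L[ℂ] H} (hP : ∀ x, P x ∈ M)
    (hP' : ∀ x, x - P x ∈ orthCompl A M) (x y : H) : inner A (P x) y = inner A x (P y) := by
  have h1 := hP' x (P y) (hP y)
  have h2 := inner_eq_zero_symm_of_cstarModule (hP' y (P x) (hP x))
  rw [CStarModule.inner_sub_left, sub_eq_zero] at h1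
  rw [CStarModule.inner_sub_right, sub_eq_zero] at h2
  rw [h1, h2]

variable [StarOrderedRing A]

/-- An orthogonally complemented submodule is the range of a bounded orthogonal projection. -/
theorem IsOrthComplemented.exists_projection {M : Submodule ℂ H} (hM : IsOrthComplemented A M) :
    ∃ P : H →L[ℂ] H, (∀ x, P x ∈ M) ∧ ∀ x, x - P x ∈ orthCompl A M := by
  let p : H →ₗ[ℂ] H := M.projection (orthCompl A M) hM.isCompl
  have h1 (x : H) : p x ∈ M := Submodule.projection_apply_mem _ x
  have h2 (x : H) : x - p x ∈ orthCompl A M :=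
    Submodule.sub_projection_mem _ x
  refine ⟨p.mkContinuous 1 fun x => ?_, h1, h2⟩
  have h3 : inner A (p x) (p x) = inner A x (p x) := by
    have h := h2 x (p x) (h1 x)
    rw [CStarModule.inner_sub_left, sub_eq_zero] at h
    exact h.symm
  have h4 : ‖p x‖ ^ 2 ≤ ‖x‖ * ‖p x‖ := by
    rw [CStarModule.norm_sq_eq A, h3]
    exact CStarModule.norm_inner_le H
  rw [one_mul]
  rcases (norm_nonneg (p x)).eq_or_lt with h | h
  · rw [← h]; exact norm_nonneg x
  · exact le_of_mul_le_mul_right (by rwa [sq] at h4) h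

/-! ### Adjointable operators with closed range -/

/-- For an adjointable operator `S` with closed range, `S S'` maps the range of `S` onto itself. -/
theorem exists_apply_adjoint_apply_eq [CompleteSpace H] {S S' : H →L[ℂ] H}
    (hS : ∀ x y, inner A (S x) y = inner A x (S' y))
    (hcl : IsClosed (S.range : Set H)) (x : H) : ∃ z, S (S' (S z)) = S x := by
  have : CompleteSpace S.range := hcl.completeSpace_coe
  let f : H →L[ℂ] S.range := S.codRestrict S.range fun x => ⟨x, rfl⟩
  have hf : Function.Surjective f := by
    rintro ⟨_, x, rfl⟩
    exact ⟨x, rfl⟩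
  obtain ⟨C, hC, hpre⟩ := f.exists_preimage_norm_le hf
  let B : S.range →L[ℂ] S.range := f ∘L S' ∘L S.range.subtypeL
  have hB : Function.Surjective B := by
    refine surjective_of_norm_le_add_smul B (K := C ^ 2) (by positivity) fun t ht y => ?_
    set u : H := S' y with hu
    set w : H := ((B y + (t : ℂ) • y : S.range) : H) with hw
    have hw' : w = S u + (t : ℂ) • (y : H) := rfl
    -- positivity of `S S'` and of `t` gives `⟪S' y, S' y⟫ ≤ ⟪(S S' + t) y, y⟫`
    have h1 : ‖u‖ ^ 2 ≤ ‖w‖ * ‖(y : H)‖ := by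
      rw [CStarModule.norm_sq_eq A]
      refine le_trans ?_ (CStarModule.norm_inner_le (A := A) H)
      refine CStarAlgebra.norm_le_norm_of_nonneg_of_le CStarModule.inner_self_nonneg ?_
      rw [hw', CStarModule.inner_add_left, hS, ← hu, CStarModule.inner_smul_left_complex,
        Complex.star_def, Complex.conj_ofReal, Complex.coe_smul]
      exact le_add_of_nonneg_right (smul_nonneg ht CStarModule.inner_self_nonneg)
    -- the open mapping theorem bounds `S'` below on the range of `S`
    have h2 : ‖(y : H)‖ ≤ C * ‖u‖ := by
      obtain ⟨x, hx, hxn⟩ := hpre y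
      have hx' : S x = y := congrArg Subtype.val hx
      have h3 : ‖(y : H)‖ ^ 2 ≤ C * ‖(y : H)‖ * ‖u‖ := by
        calc ‖(y : H)‖ ^ 2 = ‖inner A x u‖ := by
              rw [CStarModule.norm_sq_eq A, hu, ← hS, hx']
          _ ≤ ‖x‖ * ‖u‖ := CStarModule.norm_inner_le H
          _ ≤ _ := by gcongr; exact hxn
      rcases (norm_nonneg (y : H)).eq_or_lt with h | h
      · rw [← h]; positivity
      · exact le_of_mul_le_mul_right (by linarith [sq ‖(y : H)‖]) h
    change ‖(y : H)‖ ≤ C ^ 2 * ‖w‖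
    rcases (norm_nonneg (y : H)).eq_or_lt with h | h
    · rw [← h]; positivity
    · refine le_of_mul_le_mul_right ?_ h
      calc ‖(y : H)‖ * ‖(y : H)‖ ≤ (C * ‖u‖) * (C * ‖u‖) := by gcongr
        _ = C ^ 2 * ‖u‖ ^ 2 := by ring
        _ ≤ C ^ 2 * (‖w‖ * ‖(y : H)‖) := by gcongr
        _ = _ := by ring
  obtain ⟨⟨_, z, rfl⟩, hz⟩ := hB (f x)
  exact ⟨z, congrArg Subtype.val hz⟩

/-- `H = range S' + ker S` for an adjointable operator `S` with closed range. -/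
theorem exists_apply_sub_adjoint_eq_zero [CompleteSpace H] {S S' : H →L[ℂ] H}
    (hS : ∀ x y, inner A (S x) y = inner A x (S' y))
    (hcl : IsClosed (S.range : Set H)) (x : H) : ∃ z, S (x - S' z) = 0 := by
  obtain ⟨z, hz⟩ := exists_apply_adjoint_apply_eq hS hcl x
  exact ⟨S z, by rw [map_sub, hz, sub_self]⟩

/-- `H = range S + ker S'` for an adjointable operator `S` with closed range. -/
theorem exists_adjoint_apply_sub_eq_zero [CompleteSpace H] {S S' : H →L[ℂ] H}
    (hS : ∀ x y, inner A (S x) y = inner A x (S' y))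
    (hcl : IsClosed (S.range : Set H)) (x : H) : ∃ z, S' (x - S z) = 0 := by
  obtain ⟨z, hz⟩ := exists_apply_adjoint_apply_eq hS hcl (S' x)
  -- `S S'` kills `v = x - S z`, hence `⟪S' v, S' v⟫ = ⟪S S' v, v⟫ = 0`
  refine ⟨z, (CStarModule.inner_self (A := A)).1 ?_⟩
  rw [← hS, map_sub, map_sub, hz, sub_self, CStarModule.inner_zero_left]

end HilbertModule

/-! ### Sums and intersections of complemented submodules -/

theorem proposition4p6 {A H : Type*} [NonUnitalCStarAlgebra A] [PartialOrder A] [StarOrderedRing A]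
    [NormedAddCommGroup H] [NormedSpace ℂ H] [SMul A H] [CStarModule A H] [CompleteSpace H]
    (M N : Submodule ℂ H)
    (hM : IsOrthComplemented A M) (hN : IsOrthComplemented A N)
    (hMN : IsClosed ((M ⊔ N : Submodule ℂ H) : Set H)) :
    IsOrthComplemented A (M ⊔ N) ∧ IsOrthComplemented A (M ⊓ N) ∧
      orthCompl A (M ⊓ N) = orthCompl A M ⊔ orthCompl A N := by
  obtain ⟨P, hP, hP'⟩ := hM.exists_projection
  obtain ⟨Q, hQ, hQ'⟩ := hN.exists_projection
  let S : H →L[ℂ] H := (1 - Q) ∘L P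
  let S' : H →L[ℂ] H := P ∘L (1 - Q)
  have S_apply (x : H) : S x = P x - Q (P x) := rfl
  have S'_apply (x : H) : S' x = P (x - Q x) := rfl
  have hS (x y : H) : inner A (S x) y = inner A x (S' y) := by
    rw [S_apply, S'_apply, CStarModule.inner_sub_left, inner_projection_left hQ hQ',
      inner_projection_left hP hP', inner_projection_left hP hP', map_sub,
      CStarModule.inner_sub_right]
  have hSmem (x : H) : S x ∈ M ⊔ N :=
    sub_mem (Submodule.mem_sup_left (hP x)) (Submodule.mem_sup_right (hQ _))
  have hQS (x : H) : Q (S x) = 0 :=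
    projection_apply_of_mem_orthCompl hQ hQ' (hQ' (P x))
  have hrange : (S.range : Set H) = ((M ⊔ N : Submodule ℂ H) : Set H) ∩ {x | Q x = 0} := by
    ext x
    constructor
    · rintro ⟨z, rfl⟩
      exact ⟨hSmem z, hQS z⟩
    · rintro ⟨hx, hQx : Q x = 0⟩
      obtain ⟨m, hm, n, hn, rfl⟩ := Submodule.mem_sup.1 hx
      rw [map_add, projection_apply_of_mem hQ hQ' hn] at hQx
      refine ⟨m, ?_⟩
      change S m = m + n
      rw [S_apply, projection_apply_of_mem hP hP' hm, ← neg_eq_of_add_eq_zero_right hQx,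
        sub_eq_add_neg]
  have hcl : IsClosed (S.range : Set H) := by
    rw [hrange]
    exact hMN.inter (isClosed_eq Q.continuous continuous_const)
  have hsum (x : H) : ∃ y ∈ M ⊔ N, ∃ w ∈ orthCompl A (M ⊔ N), y + w = x := by
    obtain ⟨z, hz⟩ := exists_adjoint_apply_sub_eq_zero hS hcl x
    refine ⟨Q x + S z, add_mem (Submodule.mem_sup_right (hQ x)) (hSmem z),
      x - Q x - S z, ?_, by abel⟩
    have hw : x - S z - Q (x - S z) = x - Q x - S z := by
      rw [map_sub, hQS, sub_zero]; abel
    rw [S'_apply, hw] at hz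
    exact mem_orthCompl_sup (mem_orthCompl_of_projection_eq_zero hP' hz) (hw ▸ hQ' (x - S z))
  have hinf (x : H) : ∃ v ∈ M ⊓ N, ∃ w ∈ orthCompl A M ⊔ orthCompl A N, v + w = x := by
    obtain ⟨z, hz⟩ := exists_apply_sub_adjoint_eq_zero hS hcl x
    set v := P (x - S' z) with hv
    have hvN : v ∈ N := by
      rw [S_apply, sub_eq_zero] at hz
      rw [hv, hz]
      exact hQ _
    have hv' : v = P x - S' z := by
      rw [hv, map_sub, S'_apply, projection_apply_of_mem hP hP' (hP _)]
    refine ⟨v, ⟨hP _, hvN⟩, S' z + (x - P x), ?_, by rw [hv']; abel⟩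
    refine add_mem ?_ (Submodule.mem_sup_left (hP' x))
    -- with `u = z - Q z ∈ N^⊥`, the vector `S' z = P u` equals `u - (u - P u)`
    have h := sub_mem (Submodule.mem_sup_right (S := orthCompl A M) (hQ' z))
      (Submodule.mem_sup_left (T := orthCompl A N) (hP' (z - Q z)))
    rwa [sub_sub_cancel] at h
  have hle : orthCompl A M ⊔ orthCompl A N ≤ orthCompl A (M ⊓ N) :=
    sup_le (orthCompl_anti inf_le_left) (orthCompl_anti inf_le_right)
  refine ⟨⟨⟨sup_smul_mem hM.isClosedSubmodule.smul_mem hN.isClosedSubmodule.smul_mem, hMN⟩,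
      disjoint_orthCompl _, codisjoint_iff.2 (eq_top_iff.2 fun x _ => ?_)⟩,
    ⟨⟨fun a x hx => ⟨hM.isClosedSubmodule.smul_mem a x hx.1,
        hN.isClosedSubmodule.smul_mem a x hx.2⟩,
        hM.isClosedSubmodule.isClosed.inter hN.isClosedSubmodule.isClosed⟩,
      disjoint_orthCompl _, codisjoint_iff.2 (eq_top_iff.2 fun x _ => ?_)⟩,
    le_antisymm (fun x hx => ?_) hle⟩
  · exact Submodule.mem_sup.2 (hsum x)
  · obtain ⟨v, hv, w, hw, h⟩ := hinf x
    exact Submodule.mem_sup.2 ⟨v, hv, w, hle hw, h⟩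
  · obtain ⟨v, hv, w, hw, rfl⟩ := hinf x
    have hv0 : v = 0 := Submodule.disjoint_def.1 (disjoint_orthCompl (A := A) (M ⊓ N)) v hv
      (by simpa using sub_mem hx (hle hw))
    rwa [hv0, zero_add]
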